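/- Let $\mathbb U=\{z\in\mathbb C:|z|<1\}$ and, for an integer $p\ge 1$, let $\mathcal A_p$ be the set of functions $f(z)=z^p+\sum_{k>p}a_kz^k$ analytic in $\mathbb U$. Let $\mathcal H[1,1]$ be the set of functions $u$ analytic in $\mathbb U$ with $u(0)=1$, and let $\mathcal Q$ be the set of functions $f$ that are analytic and injective on $\overline{\mathbb U}\setminus E(f)$, where $E(f)=\{\zeta\in\partial\mathbb U:\lim_{z\to\zeta}f(z)=\infty\}$, with $f'(\zeta)\ne0$ for $\zeta\in\partial\mathbb U\setminus E(f)$. Write $f\prec g$ ($f$ is subordinate to $g$) if $f=g\circ w$ for some analytic $w:\mathbb U\to\mathbb U$ with $|w(z)|\le|z|$. Univalent means analytic and injective in $\mathbb U$; convex univalent means univalent with convex image of $\mathbb U$. Let $(L_p^a)$ be a family of linear operators from $\mathcal A_p$ to $\mathcal A_p$, indexed by a set of complex parameters $a$ closed under $a\mapsto a+1$ (linearity meaning compatibility with the combinations $cf+(1-c)g$, $c\in\mathbb C$, under which $\mathcal A_p$ is closed), and let $\alpha_a$ be complex numbers such that, for all $f\in\mathcal A_p$, $$z(L_p^af)'=\alpha_aL_p^{a+1}f-(\alpha_a-p)L_p^af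 .$$ Let $\mu,\nu$ be real numbers, not both $0$, let $f\in\mathcal A_p$, and let $$\Omega(z)=\Omega^a_{L,\mu,\nu}(f(z))=\left(\frac{L_p^{a+1}f(z)}{z^p}\right)^{\mu}\left(\frac{z^p}{L_p^af(z)}\right)^{\nu},$$ where the branch is the one with $\Omega(0)=1$ and $\Omega$ is assumed to be analytic in $\mathbb U$ (removable singularities being removed). Let $\psi$ be convex univalent in $\mathbb U$ with $\psi(0)=1$, and suppose $\operatorname{Re}(\alpha_{a+1}\mu-\alpha_a\nu)\ge0$ and $\alpha_{a+1}\ne0$. Put $$\chi(z)=\frac1{\alpha_{a+1}}\left[(\alpha_{a+1}\mu-\alpha_a\nu)\psi(z)+z\psi'(z)\right],\qquad \Phi(z)=\Omega(z)\left(\mu\,\Omega^{a+1}_{L,1,1}(f(z))-\frac{\alpha_a\nu}{\alpha_{a+1}}\,\Omega^{a}_{L,1,1}(f(z))\right),$$ where removable singularities of $\Phi$ are removed, and for $u$ analytic in $\mathbb U$ put $T u(z)=\frac1{\alpha_{a+1}}\left[(\alpha_{a+1}\mu-\alpha_a\nu)u(z)+zu'(z)\right]$. (1) If $\Phi\prec\chi$,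 then $\Omega\prec\psi$, and $\psi$ is the best dominant of the differential subordination $Tu\prec\chi$: $\psi$ is univalent, $u\prec\psi$ for every $u\in\mathcal H[1,1]$ with $Tu\prec\chi$, and $\psi\prec\tilde\psi$ for every other univalent $\tilde\psi$ that dominates all these $u$ in the same way. (2) If $\chi\prec\Phi$, $\Omega\in\mathcal H[1,1]\cap\mathcal Q$ and $\Phi$ is univalent in $\mathbb U$, then $\psi\prec\Omega$, and $\psi$ is the best subordinant of the differential superordination $\chi\prec Tu$: $\psi$ is univalent, $\psi\prec u$ for every univalent $u\in\mathcal H[1,1]$ with $Tu$ univalent and $\chi\prec Tu$, and $\tilde\psi\prec\psi$ for every other analytic $\tilde\psi$ that is subordinate to all these $u$. -/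

import Mathlib

open Complex Metric Set Filter Topology

namespace GFT

/-- The open unit disk. -/
def U : Set ℂ := ball (0 : ℂ) 1

/-- `f` is analytic in the unit disk (functions are total, only their values on `U` matter). -/
def Hol (f : ℂ → ℂ) : Prop := DifferentiableOn ℂ f U

/-- The class `H[c, n]` of functions `c + c_n z ^ n + c_{n+1} z ^ (n+1) + ...` analytic in `U`. -/
def MemH (c : ℂ) (n : ℕ) (f : ℂ → ℂ) : Prop :=
  ∃ g : ℂ → ℂ, Hol g ∧ ∀ z ∈ U, f z = c + z ^ n * g z

/-- The class `A_p` of functions `z ^ p + a_{p+1} z ^ (p+1) + ...` analytic in `U`. -/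
def MemA (p : ℕ) (f : ℂ → ℂ) : Prop :=
  ∃ g : ℂ → ℂ, Hol g ∧ ∀ z ∈ U, f z = z ^ p + z ^ (p + 1) * g z

/-- Univalent: analytic and injective in the unit disk. -/
def Univalent (f : ℂ → ℂ) : Prop := Hol f ∧ InjOn f U

/-- Convex univalent: univalent with a convex image of the unit disk. -/
def ConvexUnivalent (f : ℂ → ℂ) : Prop := Univalent f ∧ Convex ℝ (f '' U)

/-- `f` is subordinate to `g` (equivalently, `g` is superordinate to `f`). -/
def Subordinate (f g : ℂ → ℂ) : Prop :=
  ∃ w : ℂ → ℂ, Hol w ∧ (∀ z ∈ U, ‖w z‖ ≤ ‖z‖) ∧ ∀ z ∈ U, f z = g (w z)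

/-- The exceptional set `E(f)`: boundary points at which `f` tends to infinity. -/
def excSet (f : ℂ → ℂ) : Set ℂ :=
  {ζ | ζ ∈ sphere (0 : ℂ) 1 ∧ Tendsto f (𝓝[U] ζ) (Bornology.cobounded ℂ)}

/-- The class `Q`: `f` extends from `U` to a function that is analytic and injective on the
closed disk without `E(f)`, with non-vanishing derivative on the circle without `E(f)`. -/
def MemQ (f : ℂ → ℂ) : Prop :=
  ∃ F : ℂ → ℂ, EqOn F f U ∧
    AnalyticOnNhd ℂ F (closedBall (0 : ℂ) 1 \ excSet f) ∧
    InjOn F (closedBall (0 : ℂ) 1 \ excSet f) ∧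
    ∀ ζ ∈ sphere (0 : ℂ) 1 \ excSet f, deriv F ζ ≠ 0

/-- The class `O_p`: a family `L a` of linear operators on `A_p`, with the parameter `a` in a set
`S` that is closed under `a ↦ a + 1`, satisfying
`z (L a f)' = α a * L (a + 1) f - (α a - p) * L a f`.
The set `A_p` is an affine subspace and not a linear one: linearity on it means
compatibility with the combinations `c f + (1 - c) g`, under which it is closed. -/
structure MemO (p : ℕ) (S : Set ℂ) (α : ℂ → ℂ) (L : ℂ → (ℂ → ℂ) → (ℂ → ℂ)) : Prop where
  shift : ∀ a ∈ S, a + 1 ∈ S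
  mapsTo : ∀ a ∈ S, ∀ f, MemA p f → MemA p (L a f)
  congr : ∀ a ∈ S, ∀ f g, MemA p f → MemA p g → EqOn f g U → EqOn (L a f) (L a g) U
  linear : ∀ a ∈ S, ∀ f g, MemA p f → MemA p g → ∀ c : ℂ, ∀ z ∈ U,
    L a (fun w => c * f w + (1 - c) * g w) z = c * L a f z + (1 - c) * L a g z
  recurrence : ∀ a ∈ S, ∀ f, MemA p f → ∀ z ∈ U,
    z * deriv (L a f) z = α a * L (a + 1) f z - (α a - p) * L a f z

/-- `Ω` is the function `(L (a+1) f / z^p) ^ μ * (z^p / L a f) ^ ν`, that is, the analytic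
function in the disk with `Ω 0 = 1` whose value, wherever both bases are defined and
non-zero, is one of the values of this product of powers. Such a function is unique, it
is given by the principal powers near `0`, and its values at the remaining (isolated)
points are those given by removing the singularities. -/
structure IsOmega (L : ℂ → (ℂ → ℂ) → (ℂ → ℂ)) (p : ℕ) (a : ℂ) (μ ν : ℝ) (f : ℂ → ℂ)
    (Ω : ℂ → ℂ) : Prop where
  hol : Hol Ω
  at_zero : Ω 0 = 1
  value : ∀ z ∈ U, z ≠ 0 → L a f z ≠ 0 → L (a + 1) f z ≠ 0 →
    ∃ s t : ℂ, exp s = L (a + 1) f z / z ^ p ∧ exp t = z ^ p / L a f z ∧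
      Ω z = exp (μ * s + ν * t)

/-- The case `μ = ν = 1`, where no branch has to be chosen. -/
noncomputable def omegaOne (L : ℂ → (ℂ → ℂ) → (ℂ → ℂ)) (p : ℕ) (a : ℂ) (f : ℂ → ℂ) (z : ℂ) : ℂ :=
  (L (a + 1) f z / z ^ p) * (z ^ p / L a f z)

noncomputable def upsilon (L : ℂ → (ℂ → ℂ) → (ℂ → ℂ)) (p : ℕ) (α : ℂ → ℂ) (a : ℂ) (μ ν : ℝ)
    (f : ℂ → ℂ) (z : ℂ) : ℂ :=
  μ * omegaOne L p (a + 1) f z - α a * ν / α (a + 1) * omegaOne L p a f z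

/-- `Φ = Ω Υ`, with removable singularities (at `0` and at zeros of `L a f`, `L (a+1) f`)
removed: the value at `z` is the limit at `z`. -/
noncomputable def phi (L : ℂ → (ℂ → ℂ) → (ℂ → ℂ)) (p : ℕ) (α : ℂ → ℂ) (a : ℂ) (μ ν : ℝ)
    (f Ω : ℂ → ℂ) (z : ℂ) : ℂ :=
  limUnder (𝓝[≠] z) (fun w => Ω w * upsilon L p α a μ ν f w)

/-- The first order differential expression `((α_{a+1} μ - α_a ν) u + z u') / α_{a+1}`. -/
noncomputable def diffExpr (α : ℂ → ℂ) (a : ℂ) (μ ν : ℝ) (u : ℂ → ℂ) (z : ℂ) : ℂ :=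
  1 / α (a + 1) * ((α (a + 1) * μ - α a * ν) * u z + z * deriv u z)

/-- `q` is a dominant of the differential subordination `T u ≺ h`, `u ∈ H[1, 1]`. -/
def IsDominant (T : (ℂ → ℂ) → (ℂ → ℂ)) (h q : ℂ → ℂ) : Prop :=
  Univalent q ∧ ∀ u : ℂ → ℂ, MemH 1 1 u → Subordinate (T u) h → Subordinate u q

def IsBestDominant (T : (ℂ → ℂ) → (ℂ → ℂ)) (h q : ℂ → ℂ) : Prop :=
  IsDominant T h q ∧ ∀ q', IsDominant T h q' → Subordinate q q'

/-- `q` is a subordinant of the differential superordination `h ≺ T u`, `u ∈ H[1, 1]`,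
where, as usual, a solution `u` and the function `T u` are required to be univalent. -/
def IsSubordinant (T : (ℂ → ℂ) → (ℂ → ℂ)) (h q : ℂ → ℂ) : Prop :=
  Hol q ∧ ∀ u : ℂ → ℂ, MemH 1 1 u → Univalent u → Univalent (T u) →
    Subordinate h (T u) → Subordinate q u

def IsBestSubordinant (T : (ℂ → ℂ) → (ℂ → ℂ)) (h q : ℂ → ℂ) : Prop :=
  Univalent q ∧ IsSubordinant T h q ∧ ∀ q', IsSubordinant T h q' → Subordinate q' q

end GFT

namespace GFT

/-! Logarithmic differentiation of `Ω`, with the recurrence at `a` and `a + 1`, gives `Φ = TΩ`. Up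
to the factor `1 / α (a + 1)`, everything then concerns `E u = c u + z u'` with `c = α (a + 1) μ - α
a ν`, `Re c ≥ 0`.

For convex `ψ` the chord ratio `(ξψ'(ξ) - zψ'(z)) / (ψ(ξ) - ψ(z))` has positive real part. So `Eψ(ξ)
- Eψ(z) = k (ψ(ξ) - ψ(z))` with `Re k > 0`: `Eψ` is univalent, and outward normal rays issuing from
`Eψ(z)` miss `Eψ(ξ)` for `|ξ| < |z|`.

If `u` is not subordinate to `ψ`, Jack's lemma gives `u(z) = ψ(ζ)` and `z u'(z) = m ζψ'(ζ)` with
`|z| < |ζ|`, `m ≥ 1`. Then `Eu(z)` lies on such a ray from `Eψ(ζ)`, which contradicts `Eu ≺ Eψ`. For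
superordination the roles of `u` and `ψ` are exchanged, and injectivity of `Eu` is contradicted. The
strict inequality `|z| < |ζ|` keeps all of this inside the disk, without boundary values. Bestness
holds because `ψ` itself solves `Tψ = χ`. -/

/-! ### Univalent functions and their inverses -/

lemma isOpen_U : IsOpen U := isOpen_ball

lemma mem_U {z : ℂ} : z ∈ U ↔ ‖z‖ < 1 := mem_ball_zero_iff

lemma zero_mem_U : (0 : ℂ) ∈ U := by simp [mem_U]

lemma isPreconnected_U : IsPreconnected U := (convex_ball 0 1).isPreconnected

lemma Hol.differentiableAt {f : ℂ → ℂ} (hf : Hol f) {z : ℂ} (hz : z ∈ U) :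
    DifferentiableAt ℂ f z :=
  DifferentiableOn.differentiableAt hf (isOpen_U.mem_nhds hz)

lemma Hol.analyticOnNhd {f : ℂ → ℂ} (hf : Hol f) : AnalyticOnNhd ℂ f U :=
  DifferentiableOn.analyticOnNhd hf isOpen_U

lemma Hol.deriv {f : ℂ → ℂ} (hf : Hol f) : Hol (deriv f) :=
  DifferentiableOn.deriv hf isOpen_U

lemma Hol.dslope {f : ℂ → ℂ} (hf : Hol f) {z : ℂ} (hz : z ∈ U) : Hol (dslope f z) :=
  (Complex.differentiableOn_dslope (isOpen_U.mem_nhds hz)).2 hf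

lemma Univalent.isOpen_image {f : ℂ → ℂ} (hf : Univalent f) {s : Set ℂ} (hs : s ⊆ U)
    (ho : IsOpen s) : IsOpen (f '' s) := by
  refine (hf.1.analyticOnNhd.is_constant_or_isOpen isPreconnected_U).resolve_left ?_ s hs ho
  rintro ⟨w, hw⟩
  have h2 : (1 / 2 : ℂ) ∈ U := by rw [mem_U]; norm_num
  have := hf.2 zero_mem_U h2 ((hw _ zero_mem_U).trans (hw _ h2).symm)
  norm_num at this

lemma Univalent.inv_apply {f : ℂ → ℂ} (hf : Univalent f) {z : ℂ} (hz : z ∈ U) :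
    Function.invFunOn f U (f z) = z := hf.2.leftInvOn_invFunOn hz

lemma Univalent.continuousAt_inv {f : ℂ → ℂ} (hf : Univalent f) {z : ℂ} (hz : z ∈ U) :
    ContinuousAt (Function.invFunOn f U) (f z) := by
  rw [ContinuousAt, hf.inv_apply hz, _root_.tendsto_nhds]
  intro s hs hzs
  refine mem_of_superset ((hf.isOpen_image inter_subset_left (isOpen_U.inter hs)).mem_nhds
    (mem_image_of_mem f ⟨hz, hzs⟩)) ?_
  rintro _ ⟨w, ⟨hw, hws⟩, rfl⟩
  rwa [mem_preimage, hf.inv_apply hw]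

lemma Univalent.eventually_right_inv {f : ℂ → ℂ} (hf : Univalent f) {z : ℂ} (hz : z ∈ U) :
    ∀ᶠ y in 𝓝 (f z), f (Function.invFunOn f U y) = y := by
  filter_upwards [(hf.isOpen_image subset_rfl isOpen_U).mem_nhds (mem_image_of_mem f hz)] with y hy
  exact Function.invFunOn_eq hy

lemma Univalent.hasDerivAt_inv_of_ne {f : ℂ → ℂ} (hf : Univalent f) {z : ℂ} (hz : z ∈ U)
    (h : deriv f z ≠ 0) : HasDerivAt (Function.invFunOn f U) (deriv f z)⁻¹ (f z) := by
  refine HasDerivAt.of_local_left_inverse (hf.continuousAt_inv hz) ?_ h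
    (hf.eventually_right_inv hz)
  rw [hf.inv_apply hz]
  exact (hf.1.differentiableAt hz).hasDerivAt

/-- The derivative of a univalent function does not vanish: the inverse is continuous, and
differentiable off a discrete set, hence analytic. -/
lemma Univalent.deriv_ne_zero {f : ℂ → ℂ} (hf : Univalent f) {z : ℂ} (hz : z ∈ U) :
    deriv f z ≠ 0 := by
  have hne : ∀ᶠ w in 𝓝[≠] z, deriv f w ≠ 0 := by
    refine ((hf.1.deriv.analyticOnNhd z hz).eventually_eq_zero_or_eventually_ne_zero).resolve_left
      fun h => ?_
    obtain ⟨ε, hε, hb⟩ := Metric.eventually_nhds_iff_ball.1 (h.and (isOpen_U.mem_nhds hz))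
    have hw : z + (ε / 2 : ℝ) ∈ ball z ε := by
      rw [mem_ball, dist_eq_norm, add_sub_cancel_left, Complex.norm_real, Real.norm_eq_abs,
        abs_of_pos (by positivity)]
      linarith
    have hc := isOpen_ball.is_const_of_deriv_eq_zero (convex_ball z ε).isPreconnected
      (hf.1.mono fun w hw => (hb w hw).2) (fun w hw => (hb w hw).1) hw (mem_ball_self hε)
    have := hf.2 (hb _ hw).2 hz hc
    simp only [add_eq_left, ofReal_eq_zero] at this
    linarith
  set g := Function.invFunOn f U with hg
  have hgz : g (f z) = z := hf.inv_apply hz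
  have hgc : ContinuousAt g (f z) := hf.continuousAt_inv hz
  have hUz : f '' U ∈ 𝓝 (f z) :=
    (hf.isOpen_image subset_rfl isOpen_U).mem_nhds (mem_image_of_mem f hz)
  have htend : Tendsto g (𝓝[≠] (f z)) (𝓝[≠] z) := by
    refine tendsto_nhdsWithin_iff.2 ⟨?_, ?_⟩
    · rw [ContinuousAt, hgz] at hgc
      exact hgc.mono_left nhdsWithin_le_nhds
    · filter_upwards [self_mem_nhdsWithin, mem_nhdsWithin_of_mem_nhds hUz] with y hy hyU hyz
      rw [mem_singleton_iff] at hyz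
      exact hy (by rw [mem_singleton_iff, ← hyz, Function.invFunOn_eq hyU])
  have hd : ∀ᶠ y in 𝓝[≠] (f z), DifferentiableAt ℂ g y := by
    filter_upwards [htend.eventually hne, mem_nhdsWithin_of_mem_nhds hUz] with y hy hyU
    obtain ⟨w, hw, rfl⟩ := hyU
    rw [hg, hf.inv_apply hw] at hy
    exact (hf.hasDerivAt_inv_of_ne hw hy).differentiableAt
  have hga := (analyticAt_of_differentiable_on_punctured_nhds_of_continuousAt hd
    hgc).differentiableAt.hasDerivAt
  have hcomp := hga.comp z (hf.1.differentiableAt hz).hasDerivAt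
  have hid : HasDerivAt (g ∘ f) 1 z := by
    refine (hasDerivAt_id z).congr_of_eventuallyEq ?_
    filter_upwards [isOpen_U.mem_nhds hz] with w hw
    exact hf.inv_apply hw
  intro h0
  rw [h0, mul_zero] at hcomp
  exact zero_ne_one (hcomp.unique hid)

lemma Univalent.hasDerivAt_inv {f : ℂ → ℂ} (hf : Univalent f) {z : ℂ} (hz : z ∈ U) :
    HasDerivAt (Function.invFunOn f U) (deriv f z)⁻¹ (f z) :=
  hf.hasDerivAt_inv_of_ne hz (hf.deriv_ne_zero hz)

/-- The lift is `q⁻¹ ∘ u`. The radius is left free because `u` may stay in the image of `q` only on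
a smaller disk. -/
lemma Univalent.exists_lift {q u : ℂ → ℂ} (hq : Univalent q) {r : ℝ}
    (hu : DifferentiableOn ℂ u (ball 0 r)) (hm : MapsTo u (ball 0 r) (q '' U)) (h0 : u 0 = q 0) :
    ∃ w : ℂ → ℂ, DifferentiableOn ℂ w (ball 0 r) ∧ MapsTo w (ball 0 r) U ∧ w 0 = 0 ∧
      ∀ z ∈ ball (0 : ℂ) r, q (w z) = u z := by
  refine ⟨Function.invFunOn q U ∘ u, fun z hz => ?_, fun z hz => ?_, ?_, fun z hz => ?_⟩
  · obtain ⟨ζ, hζ, hζz⟩ := hm hz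
    refine DifferentiableAt.comp_differentiableWithinAt z ?_ (hu z hz)
    rw [← hζz]
    exact (hq.hasDerivAt_inv hζ).differentiableAt
  · exact Function.invFunOn_mem (hm hz)
  · rw [Function.comp_apply, h0, hq.inv_apply zero_mem_U]
  · exact Function.invFunOn_eq (hm hz)

lemma norm_le_of_mapsTo_U {w : ℂ → ℂ} (hw : Hol w) (hm : MapsTo w U U) (h0 : w 0 = 0) {z : ℂ}
    (hz : z ∈ U) : ‖w z‖ ≤ ‖z‖ :=
  norm_le_norm_of_mapsTo_ball (R := 1) hw (fun _ hx => ball_subset_closedBall (hm hx)) h0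
    (mem_U.1 hz)

/-! ### Jack's lemma and points of contact -/

lemma re_deriv_nonpos {φ : ℝ → ℂ} {d : ℂ} (hφ : HasDerivAt φ d 0)
    (h : ∀ s : ℝ, 0 < s → s < 1 → (φ s).re ≤ (φ 0).re) : d.re ≤ 0 := by
  have hre : HasDerivAt (fun s => (φ s).re) d.re 0 := by
    simpa using! (Complex.reCLM.hasFDerivAt.comp_hasDerivAt (0 : ℝ) hφ)
  refine le_of_tendsto hre.tendsto_slope_zero_right ?_
  filter_upwards [Ioo_mem_nhdsGT (zero_lt_one' ℝ)] with s hs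
  simp only [zero_add, smul_eq_mul]
  exact mul_nonpos_of_nonneg_of_nonpos (inv_nonneg.2 hs.1.le) (sub_nonpos.2 (h s hs.1 hs.2))

/-- At a point where the modulus is maximal over the disk through that point, the logarithmic
derivative `z g' / g` is real and non-negative. -/
lemma exists_logDeriv_of_norm_max {g : ℂ → ℂ} {z : ℂ} (hg : DifferentiableAt ℂ g z)
    (hgz : g z ≠ 0) (hmax : ∀ x : ℂ, ‖x‖ ≤ ‖z‖ → ‖g x‖ ≤ ‖g z‖) :
    ∃ k : ℝ, 0 ≤ k ∧ z * deriv g z = k * g z := by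
  set X : ℂ := z * deriv g z / g z with hX
  -- The path `z * exp (-s c)` stays in the disk of radius `‖z‖` for `s ≥ 0`, and `Re (g / g z)` has
  -- derivative `-Re (X c)` along it at `s = 0`. The choices `c = 1, I, -I` give `Re X ≥ 0` and `Im
  -- X = 0`.
  have key : ∀ c : ℂ, 0 ≤ c.re → 0 ≤ (X * c).re := by
    intro c hc
    have h1 : HasDerivAt (fun s : ℂ => z * exp (-s * c)) (-(z * c)) 0 := by
      have := (((hasDerivAt_id (0 : ℂ)).neg.mul_const c).cexp).const_mul z
      simpa using! this
    have hg' : HasDerivAt g (deriv g z) (z * exp (-0 * c)) := by simpa using hg.hasDerivAt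
    have h2 := ((hg'.comp (0 : ℂ) h1).div_const (g z)).comp_ofReal
    have h3 := re_deriv_nonpos h2 ?_
    · have : deriv g z * -(z * c) / g z = -(X * c) := by rw [hX]; ring
      rw [this, neg_re] at h3
      linarith
    · intro s hs _
      have hle : ‖g (z * exp (-(s : ℂ) * c)) / g z‖ ≤ 1 := by
        rw [norm_div]
        refine div_le_one_of_le₀ (hmax _ ?_) (norm_nonneg _)
        rw [norm_mul, Complex.norm_exp]
        refine mul_le_of_le_one_right (norm_nonneg _) (Real.exp_le_one_iff.2 ?_)
        simp only [neg_mul, neg_re, re_ofReal_mul]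
        have := mul_nonneg hs.le hc
        linarith
      have h4 := (re_le_norm (g (z * exp (-(s : ℂ) * c)) / g z)).trans hle
      simpa [hgz] using! h4
  have h1 := key 1 (by simp)
  have h2 := key I (by simp)
  have h3 := key (-I) (by simp)
  simp only [mul_one, mul_neg, neg_re, mul_re, I_re, mul_zero, I_im, zero_sub] at h1 h2 h3
  refine ⟨X.re, h1, ?_⟩
  have : X = X.re := Complex.ext (by simp) (by simp; linarith)
  rw [← this, hX, div_mul_cancel₀ _ hgz]

/-- Jack's lemma, for a function that violates the conclusion of the Schwarz lemma. -/
lemma exists_jack_point {w : ℂ → ℂ} {r : ℝ} (hw : DifferentiableOn ℂ w (ball 0 r))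
    (h0 : w 0 = 0) {z₁ : ℂ} (hz₁ : z₁ ∈ ball (0 : ℂ) r) (hlt : ‖z₁‖ < ‖w z₁‖) :
    ∃ z ∈ ball (0 : ℂ) r, ‖z‖ < ‖w z‖ ∧ ∃ m : ℝ, 1 ≤ m ∧ z * deriv w z = m * w z := by
  have hz₁0 : z₁ ≠ 0 := by
    rintro rfl
    simp [h0] at hlt
  have hz₁n : 0 < ‖z₁‖ := norm_pos_iff.2 hz₁0
  have hr : 0 < r := hz₁n.trans (mem_ball_zero_iff.1 hz₁)
  -- Here `g = w / z`. Its maximum modulus on the circle through `z₁` exceeds `1`, and `z w' / w = 1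
  -- + z g' / g` at a maximum point.
  set g := dslope w 0 with hg
  have hgd : DifferentiableOn ℂ g (ball 0 r) :=
    (Complex.differentiableOn_dslope (ball_mem_nhds 0 hr)).2 hw
  have hwg : ∀ z, w z = z * g z := by
    intro z
    have := sub_smul_dslope w 0 z
    simpa [h0] using this.symm
  have hcl : closedBall (0 : ℂ) ‖z₁‖ ⊆ ball 0 r :=
    closedBall_subset_ball (mem_ball_zero_iff.1 hz₁)
  obtain ⟨z, hz, hmax⟩ := exists_mem_frontier_isMaxOn_norm (f := g) (U := ball 0 ‖z₁‖)
    isBounded_ball ⟨0, mem_ball_self hz₁n⟩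
    (DifferentiableOn.diffContOnCl (by
      rw [closure_ball _ hz₁n.ne']
      exact hgd.mono hcl))
  rw [frontier_ball _ hz₁n.ne', mem_sphere_zero_iff_norm] at hz
  rw [closure_ball _ hz₁n.ne'] at hmax
  have hzr : z ∈ ball (0 : ℂ) r := hcl (by simp [hz])
  have hgda : DifferentiableAt ℂ g z := hgd.differentiableAt (isOpen_ball.mem_nhds hzr)
  have h1 : 1 < ‖g z₁‖ := by
    rw [hwg, norm_mul] at hlt
    exact (lt_mul_iff_one_lt_right hz₁n).1 hlt
  have h2 : 1 < ‖g z‖ := h1.trans_le (hmax (by simp : z₁ ∈ closedBall (0 : ℂ) ‖z₁‖))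
  obtain ⟨k, hk, hkz⟩ := exists_logDeriv_of_norm_max hgda
    (norm_pos_iff.1 (zero_lt_one.trans h2)) fun x hx => hmax (by simpa [hz] using hx)
  refine ⟨z, hzr, ?_, 1 + k, by linarith, ?_⟩
  · rw [hwg z, norm_mul]
    exact (lt_mul_iff_one_lt_right (by rw [hz]; exact hz₁n)).2 h2
  · have hd : HasDerivAt w (1 * g z + z * deriv g z) z :=
      ((hasDerivAt_id z).mul hgda.hasDerivAt).congr_of_eventuallyEq
        (Eventually.of_forall hwg)
    rw [hd.deriv, hkz, hwg z]
    push_cast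
    ring

/-- If `u` is not subordinate to the univalent function `q`, then there is a point of contact at
which the derivatives are related as in Jack's lemma. -/
lemma Univalent.exists_contact {q u : ℂ → ℂ} (hq : Univalent q) (hu : Hol u) (h0 : u 0 = q 0)
    (hns : ¬ Subordinate u q) :
    ∃ z ∈ U, ∃ ζ ∈ U, ‖z‖ < ‖ζ‖ ∧ u z = q ζ ∧
      ∃ m : ℝ, 1 ≤ m ∧ z * deriv u z = m * (ζ * deriv q ζ) := by
  -- On a disk where `u` stays in `q '' U`, the lift exists, and a point where it violates the
  -- Schwarz bound feeds Jack's lemma.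
  have main : ∀ r : ℝ, r ≤ 1 → MapsTo u (ball 0 r) (q '' U) → ∀ z₁ ∈ ball (0 : ℂ) r,
      (¬ ∃ ζ, ‖ζ‖ ≤ ‖z₁‖ ∧ q ζ = u z₁) →
      ∃ z ∈ U, ∃ ζ ∈ U, ‖z‖ < ‖ζ‖ ∧ u z = q ζ ∧
        ∃ m : ℝ, 1 ≤ m ∧ z * deriv u z = m * (ζ * deriv q ζ) := by
    intro r hr hm z₁ hz₁ hne
    have hrU : ball (0 : ℂ) r ⊆ U := ball_subset_ball hr
    obtain ⟨w, hwd, hwm, hw0, hw⟩ := hq.exists_lift (hu.mono hrU) hm h0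
    have hlt : ‖z₁‖ < ‖w z₁‖ := by
      by_contra! h
      exact hne ⟨w z₁, h, hw z₁ hz₁⟩
    obtain ⟨z, hz, hzw, m, hm1, hmz⟩ := exists_jack_point hwd hw0 hz₁ hlt
    refine ⟨z, hrU hz, w z, hwm hz, hzw, (hw z hz).symm, m, hm1, ?_⟩
    have hd : HasDerivAt u (deriv q (w z) * deriv w z) z := by
      refine ((hq.1.differentiableAt (hwm hz)).hasDerivAt.comp z
        (hwd.differentiableAt (isOpen_ball.mem_nhds hz)).hasDerivAt).congr_of_eventuallyEq ?_
      filter_upwards [isOpen_ball.mem_nhds hz] with x hx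
      exact (hw x hx).symm
    rw [hd.deriv]
    linear_combination deriv q (w z) * hmz
  by_cases hC : MapsTo u U (q '' U)
  · obtain ⟨w, hwd, hwm, hw0, hw⟩ := hq.exists_lift (r := 1) hu hC h0
    refine absurd ⟨w, hwd, fun z hz => norm_le_of_mapsTo_U hwd hwm hw0 hz,
      fun z hz => (hw z hz).symm⟩ hns
  · obtain ⟨z₁, hz₁, hz₁q⟩ : ∃ z ∈ U, u z ∉ q '' U := by
      simpa [MapsTo] using hC
    have hqo : IsOpen (q '' U) := hq.isOpen_image subset_rfl isOpen_U
    have hsub : closedBall (0 : ℂ) ‖z₁‖ ⊆ U := closedBall_subset_ball (mem_U.1 hz₁)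
    -- Take `x` of least modulus with `u x` outside `q '' U`. Without a contact point, `u` maps the
    -- open disk of radius `‖x‖` into the compact set `q '' closedBall 0 ‖x‖`, which then also
    -- contains `u x`.
    have hK : IsCompact (closedBall (0 : ℂ) ‖z₁‖ ∩ u ⁻¹' (q '' U)ᶜ) :=
      (isCompact_closedBall 0 _).of_isClosed_subset
        ((hu.continuousOn.mono hsub).preimage_isClosed_of_isClosed isClosed_closedBall
          hqo.isClosed_compl) inter_subset_left
    obtain ⟨x, ⟨hx1, hxq⟩, hxmin⟩ := hK.exists_isMinOn
      ⟨z₁, by simp, hz₁q⟩ continuous_norm.continuousOn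
    have hxU : x ∈ U := hsub hx1
    have hm : MapsTo u (ball 0 ‖x‖) (q '' U) := by
      intro y hy
      by_contra hyq
      rw [mem_ball_zero_iff] at hy
      refine hy.not_ge (hxmin ⟨?_, hyq⟩)
      rw [mem_closedBall_zero_iff] at hx1 ⊢
      exact hy.le.trans hx1
    have hx0 : x ≠ 0 := by
      rintro rfl
      exact hxq ⟨0, zero_mem_U, h0.symm⟩
    by_contra hcon
    have hin : ∀ y ∈ ball (0 : ℂ) ‖x‖, u y ∈ q '' closedBall 0 ‖x‖ := by
      intro y hy
      by_contra hyq
      refine hcon (main ‖x‖ (mem_U.1 hxU).le hm y hy ?_)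
      rintro ⟨ζ, hζ, hζy⟩
      exact hyq ⟨ζ, by simpa using hζ.trans (mem_ball_zero_iff.1 hy).le, hζy⟩
    have hxsub : closedBall (0 : ℂ) ‖x‖ ⊆ U := closedBall_subset_ball (mem_U.1 hxU)
    have hcl : IsClosed (q '' closedBall 0 ‖x‖) :=
      ((isCompact_closedBall _ _).image_of_continuousOn (hq.1.continuousOn.mono hxsub)).isClosed
    have hxc : u x ∈ closure (u '' ball 0 ‖x‖) := by
      refine ContinuousWithinAt.mem_closure_image
        (hu.differentiableAt hxU).continuousAt.continuousWithinAt ?_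
      rw [closure_ball _ (norm_ne_zero_iff.2 hx0)]
      simp
    obtain ⟨y, hy, hyx⟩ := closure_minimal (image_subset_iff.2 hin : u '' ball 0 ‖x‖ ⊆ q '' closedBall 0 ‖x‖) hcl hxc
    exact hxq ⟨y, hxsub hy, hyx⟩

/-! ### Convex functions: support lines and chords -/

/-- The values of a convex univalent function on a disk lie on one side of the tangent line to
the image of the bounding circle. -/
lemma ConvexUnivalent.re_support {ψ : ℂ → ℂ} (hψ : ConvexUnivalent ψ) {z ξ : ℂ} (hz : z ∈ U)
    (hξ : ‖ξ‖ ≤ ‖z‖) : ((ψ ξ - ψ z) / (z * deriv ψ z)).re ≤ 0 := by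
  rcases eq_or_ne z 0 with rfl | hz0
  · simp
  have hzn : 0 < ‖z‖ := norm_pos_iff.2 hz0
  set κ := ξ / z with hκ
  have hκ1 : ‖κ‖ ≤ 1 := by
    rw [hκ, norm_div]
    exact div_le_one_of_le₀ hξ (norm_nonneg _)
  have hκz : κ * z = ξ := div_mul_cancel₀ _ hz0
  have hκU : ∀ x ∈ U, κ * x ∈ U := fun x hx => by
    rw [mem_U] at hx ⊢
    rw [norm_mul]
    exact (mul_le_of_le_one_left (norm_nonneg _) hκ1).trans_lt hx
  set g := Function.invFunOn ψ U with hg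
  have hgz : g (ψ z) = z := hψ.1.inv_apply hz
  -- By convexity `(1 - t) ψ(x) + t ψ(κ x)` takes values in `ψ '' U`, so the Schwarz lemma applies
  -- to its lift. The claim is the case `x = z`.
  have hin : ∀ t : ℝ, 0 < t → t < 1 → ‖g (ψ z + t * (ψ ξ - ψ z))‖ ≤ ‖z‖ := by
    intro t ht0 ht1
    have hF : Hol fun x => ψ x + t * (ψ (κ * x) - ψ x) := by
      have h1 : Hol fun x => ψ (κ * x) :=
        DifferentiableOn.comp hψ.1.1 (by fun_prop : DifferentiableOn ℂ (fun x => κ * x) U) hκU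
      exact DifferentiableOn.add hψ.1.1
        ((DifferentiableOn.sub h1 hψ.1.1).const_mul (t : ℂ))
    have hm : MapsTo (fun x => ψ x + t * (ψ (κ * x) - ψ x)) U (ψ '' U) := by
      intro x hx
      have := hψ.2 (mem_image_of_mem ψ hx) (mem_image_of_mem ψ (hκU x hx))
        (by linarith : 0 ≤ 1 - t) ht0.le (by ring)
      convert this using 1
      simp only [real_smul, ofReal_sub, ofReal_one]
      ring
    obtain ⟨w, hwd, hwm, hw0, hw⟩ := hψ.1.exists_lift (r := 1) hF hm (by simp)
    have h2 := hw z hz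
    rw [hκz] at h2
    rw [← h2, hg, hψ.1.inv_apply (hwm hz)]
    exact norm_le_of_mapsTo_U hwd hwm hw0 hz
  have h1 : HasDerivAt (fun t : ℂ => ψ z + t * (ψ ξ - ψ z)) (ψ ξ - ψ z) 0 := by
    simpa using ((hasDerivAt_id (0 : ℂ)).mul_const (ψ ξ - ψ z)).const_add (ψ z)
  have h2 : HasDerivAt g (deriv ψ z)⁻¹ (ψ z + 0 * (ψ ξ - ψ z)) := by
    simpa using hψ.1.hasDerivAt_inv hz
  have h3 := re_deriv_nonpos ((h2.comp (0 : ℂ) h1).div_const z).comp_ofReal ?_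
  · convert h3 using 2
    ring
  · intro s hs0 hs1
    have h4 : ‖g (ψ z + s * (ψ ξ - ψ z)) / z‖ ≤ 1 := by
      rw [norm_div]
      exact div_le_one_of_le₀ (hin s hs0 hs1) (norm_nonneg _)
    have h5 := (re_le_norm _).trans h4
    simpa [hgz, hz0] using! h5

lemma Univalent.dslope_ne_zero {f : ℂ → ℂ} (hf : Univalent f) {z ξ : ℂ} (hz : z ∈ U)
    (hξ : ξ ∈ U) : dslope f z ξ ≠ 0 := by
  rcases eq_or_ne ξ z with rfl | h
  · rw [dslope_same]
    exact hf.deriv_ne_zero hz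
  · intro h0
    have := sub_smul_dslope f z ξ
    rw [h0, smul_zero, eq_comm, sub_eq_zero] at this
    exact h (hf.2 hξ hz this)

/-- The quotient of the difference quotients of `z ψ'` and of `ψ`. -/
noncomputable def chordRatio (ψ : ℂ → ℂ) (z ξ : ℂ) : ℂ :=
  dslope (fun x => x * deriv ψ x) z ξ / dslope ψ z ξ

lemma Univalent.hol_chordRatio {ψ : ℂ → ℂ} (hψ : Univalent ψ) {z : ℂ} (hz : z ∈ U) :
    Hol (chordRatio ψ z) := by
  have hH : Hol fun x => x * _root_.deriv ψ x := DifferentiableOn.mul differentiableOn_id hψ.1.deriv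
  exact DifferentiableOn.div (hH.dslope hz) (hψ.1.dslope hz) fun ξ hξ => hψ.dslope_ne_zero hz hξ

lemma chordRatio_of_ne (ψ : ℂ → ℂ) {z ξ : ℂ} (h : ξ ≠ z) :
    chordRatio ψ z ξ = (ξ * deriv ψ ξ - z * deriv ψ z) / (ψ ξ - ψ z) := by
  rw [chordRatio, dslope_of_ne _ h, dslope_of_ne _ h, slope_def_field, slope_def_field,
    div_div_div_cancel_right₀ (sub_ne_zero.2 h)]

lemma chordRatio_comm (ψ : ℂ → ℂ) (z ξ : ℂ) : chordRatio ψ z ξ = chordRatio ψ ξ z := by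
  rcases eq_or_ne ξ z with rfl | h
  · rfl
  · rw [chordRatio_of_ne _ h, chordRatio_of_ne _ h.symm, ← neg_div_neg_eq, neg_sub, neg_sub]

lemma re_inv_nonpos {x : ℂ} (hx : x.re ≤ 0) : (x⁻¹).re ≤ 0 := by
  rw [inv_re]
  exact div_nonpos_of_nonpos_of_nonneg hx (normSq_nonneg _)

/-- With equal moduli the support inequality is available at both ends of the chord, and the ratio
is minus the sum of the two inverted support quotients. -/
lemma ConvexUnivalent.re_chordRatio_nonneg_of_norm_eq {ψ : ℂ → ℂ} (hψ : ConvexUnivalent ψ)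
    {z ξ : ℂ} (hz : z ∈ U) (h : ‖ξ‖ = ‖z‖) (hne : ξ ≠ z) : 0 ≤ (chordRatio ψ z ξ).re := by
  have hξ : ξ ∈ U := by rw [mem_U, h]; exact mem_U.1 hz
  have h1 := re_inv_nonpos (hψ.re_support hz h.le)
  have h2 := re_inv_nonpos (hψ.re_support hξ h.ge)
  have h3 : chordRatio ψ z ξ =
      -(((ψ ξ - ψ z) / (z * deriv ψ z))⁻¹ + ((ψ z - ψ ξ) / (ξ * deriv ψ ξ))⁻¹) := by
    rw [chordRatio_of_ne _ hne, inv_div, inv_div, ← neg_sub (ψ ξ) (ψ z), div_neg]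
    ring
  rw [h3, neg_re, add_re]
  linarith

/-- Serves to reach the diagonal value `chordRatio ψ z z` as a limit along the circle. -/
lemma exists_tendsto_norm_eq {z : ℂ} (hz : z ≠ 0) :
    ∃ s : ℕ → ℂ, Tendsto s atTop (𝓝 z) ∧ ∀ n, ‖s n‖ = ‖z‖ ∧ s n ≠ z := by
  refine ⟨fun n => z * exp ((1 / ((n : ℝ) + 1) : ℝ) * I), ?_, fun n => ⟨?_, ?_⟩⟩
  · have h : Continuous fun t : ℝ => z * exp (t * I) := by fun_prop
    have := (h.tendsto 0).comp tendsto_one_div_add_atTop_nhds_zero_nat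
    simpa [Function.comp_def] using! this
  · rw [norm_mul, norm_exp_ofReal_mul_I, mul_one]
  · intro (h : z * exp ((1 / ((n : ℝ) + 1) : ℝ) * I) = z)
    have h3 : 0 < (1 / ((n : ℝ) + 1) : ℝ) := by positivity
    have h4 : (1 / ((n : ℝ) + 1) : ℝ) ≤ 1 := by
      rw [div_le_one (by positivity)]
      linarith [(Nat.cast_nonneg n : (0 : ℝ) ≤ n)]
    generalize (1 / ((n : ℝ) + 1) : ℝ) = e at h h3 h4
    have h1 : exp (e * I) = 1 := mul_left_cancel₀ hz (by simpa using h)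
    obtain ⟨m, hm⟩ := Complex.exp_eq_one_iff.1 h1
    have h2 : e = m * (2 * Real.pi) := by simpa using congrArg Complex.im hm
    have hpi := Real.pi_gt_three
    rw [h2] at h3 h4
    have hm0 : (0 : ℝ) < m := pos_of_mul_pos_left h3 (by positivity)
    have hm1 : (1 : ℝ) ≤ m := by exact_mod_cast hm0
    nlinarith

/-- The case of equal moduli extends inwards by the maximum principle for `exp (-chordRatio ψ z)`.
-/
lemma ConvexUnivalent.re_chordRatio_nonneg_of_norm_le {ψ : ℂ → ℂ} (hψ : ConvexUnivalent ψ)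
    {z ξ : ℂ} (hz : z ∈ U) (hz0 : z ≠ 0) (h : ‖ξ‖ ≤ ‖z‖) : 0 ≤ (chordRatio ψ z ξ).re := by
  have hzn := norm_pos_iff.2 hz0
  have hsub : closedBall (0 : ℂ) ‖z‖ ⊆ U := closedBall_subset_ball (mem_U.1 hz)
  have hhol := hψ.1.hol_chordRatio hz
  have hsph : ∀ x, ‖x‖ = ‖z‖ → 0 ≤ (chordRatio ψ z x).re := by
    intro x hx
    rcases eq_or_ne x z with rfl | hne
    · obtain ⟨s, hs, hsx⟩ := exists_tendsto_norm_eq hz0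
      refine ge_of_tendsto' ((continuous_re.tendsto _).comp
        ((hhol.differentiableAt hz).continuousAt.tendsto.comp hs)) fun n => ?_
      exact hψ.re_chordRatio_nonneg_of_norm_eq hz (hsx n).1 (hsx n).2
    · exact hψ.re_chordRatio_nonneg_of_norm_eq hz hx hne
  have hE : DifferentiableOn ℂ (fun x => exp (-chordRatio ψ z x)) U := hhol.neg.cexp
  have := norm_le_of_forall_mem_frontier_norm_le (U := ball (0 : ℂ) ‖z‖) isBounded_ball
    (f := fun x => exp (-chordRatio ψ z x)) (C := 1) (z := ξ)
    (DifferentiableOn.diffContOnCl (by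
      rw [closure_ball _ hzn.ne']
      exact hE.mono hsub))
    (by
      intro x hx
      rw [frontier_ball _ hzn.ne', mem_sphere_zero_iff_norm] at hx
      rw [Complex.norm_exp, Real.exp_le_one_iff, neg_re]
      linarith [hsph x hx])
    (by
      rw [closure_ball _ hzn.ne']
      simpa using h)
  rw [Complex.norm_exp, Real.exp_le_one_iff, neg_re] at this
  linarith

/-- By the open mapping theorem, a nonconstant `g` has its image in the interior of the half-plane.
-/
lemma re_pos_of_re_nonneg {g : ℂ → ℂ} (hg : Hol g) (h : ∀ z ∈ U, 0 ≤ (g z).re)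
    {z₀ : ℂ} (hz₀ : z₀ ∈ U) (h₀ : 0 < (g z₀).re) {z : ℂ} (hz : z ∈ U) : 0 < (g z).re := by
  rcases hg.analyticOnNhd.is_constant_or_isOpen isPreconnected_U with ⟨w, hw⟩ | ho
  · rwa [hw z hz, ← hw z₀ hz₀]
  · have h1 : g '' U ⊆ interior {w : ℂ | 0 ≤ w.re} :=
      interior_maximal (image_subset_iff.2 h) (ho U subset_rfl isOpen_U)
    rw [Complex.interior_setOfPred_le_re] at h1
    exact h1 (mem_image_of_mem g hz)

/-- Strict positivity spreads from the value `1` at `(0, 0)` to `(0, x)`, by symmetry to `(z, 0)`,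
and from there to `(z, ξ)`. -/
lemma ConvexUnivalent.re_chordRatio_pos {ψ : ℂ → ℂ} (hψ : ConvexUnivalent ψ)
    {z ξ : ℂ} (hz : z ∈ U) (hξ : ξ ∈ U) : 0 < (chordRatio ψ z ξ).re := by
  have h00 : chordRatio ψ 0 0 = 1 := by
    have hd : HasDerivAt (fun x => x * deriv ψ x) (1 * deriv ψ 0 + 0 * deriv (deriv ψ) 0) 0 :=
      (hasDerivAt_id (0 : ℂ)).mul (hψ.1.1.deriv.differentiableAt zero_mem_U).hasDerivAt
    rw [chordRatio, dslope_same, dslope_same, hd.deriv, one_mul, zero_mul, add_zero,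
      div_self (hψ.1.deriv_ne_zero zero_mem_U)]
  have hnn : ∀ x ∈ U, ∀ y ∈ U, 0 ≤ (chordRatio ψ x y).re := by
    intro x hx y hy
    by_cases hx0 : x = 0
    · by_cases hy0 : y = 0
      · simp [hx0, hy0, h00]
      · rw [chordRatio_comm]
        exact hψ.re_chordRatio_nonneg_of_norm_le hy hy0 (by simp [hx0])
    · rcases le_total ‖y‖ ‖x‖ with h | h
      · exact hψ.re_chordRatio_nonneg_of_norm_le hx hx0 h
      · rw [chordRatio_comm]
        refine hψ.re_chordRatio_nonneg_of_norm_le hy ?_ h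
        exact norm_pos_iff.1 ((norm_pos_iff.2 hx0).trans_le h)
  have h0 : ∀ x ∈ U, 0 < (chordRatio ψ 0 x).re := fun x hx =>
    re_pos_of_re_nonneg (hψ.1.hol_chordRatio zero_mem_U) (hnn 0 zero_mem_U) zero_mem_U
      (by simp [h00]) hx
  refine re_pos_of_re_nonneg (hψ.1.hol_chordRatio hz) (hnn z hz) zero_mem_U ?_ hξ
  rw [chordRatio_comm]
  exact h0 z hz

/-! ### The operator `c u + z u'` and the two comparison theorems -/

/-- The differential operator `c u + z u'`. -/
noncomputable def eulerOp (c : ℂ) (u : ℂ → ℂ) (z : ℂ) : ℂ := c * u z + z * deriv u z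

lemma Hol.eulerOp {u : ℂ → ℂ} (hu : Hol u) (c : ℂ) : Hol (eulerOp c u) :=
  DifferentiableOn.add (DifferentiableOn.const_mul hu c)
    (DifferentiableOn.mul differentiableOn_id hu.deriv)

/-- `c ψ + z ψ'` is close-to-convex with respect to `ψ`, in terms of chords. -/
lemma ConvexUnivalent.exists_eulerOp_sub {ψ : ℂ → ℂ} (hψ : ConvexUnivalent ψ) {c : ℂ}
    (hc : 0 ≤ c.re) {z ξ : ℂ} (hz : z ∈ U) (hξ : ξ ∈ U) :
    ∃ k : ℂ, 0 < k.re ∧ eulerOp c ψ ξ - eulerOp c ψ z = k * (ψ ξ - ψ z) := by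
  refine ⟨c + chordRatio ψ z ξ, ?_, ?_⟩
  · rw [add_re]
    linarith [hψ.re_chordRatio_pos hz hξ]
  · rcases eq_or_ne ξ z with rfl | h
    · simp
    · have hne : ψ ξ - ψ z ≠ 0 := sub_ne_zero.2 fun h' => h (hψ.1.2 hξ hz h')
      rw [chordRatio_of_ne _ h, add_mul, div_mul_cancel₀ _ hne, eulerOp, eulerOp]
      ring

lemma ConvexUnivalent.univalent_eulerOp {ψ : ℂ → ℂ} (hψ : ConvexUnivalent ψ) {c : ℂ}
    (hc : 0 ≤ c.re) : Univalent (eulerOp c ψ) := by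
  refine ⟨hψ.1.1.eulerOp c, fun x hx y hy hxy => ?_⟩
  obtain ⟨k, hk, h⟩ := hψ.exists_eulerOp_sub hc hy hx
  rw [hxy, sub_self, eq_comm, mul_eq_zero] at h
  rcases h with rfl | h
  · simp at hk
  · exact hψ.1.2 hx hy (sub_eq_zero.1 h)

/-- The rays in the direction of the outer normal to the image under `ψ` of a circle, issuing from
the image of the circle under `c ψ + z ψ'`, do not meet the image of the disk. -/
lemma ConvexUnivalent.eulerOp_ne_add {ψ : ℂ → ℂ} (hψ : ConvexUnivalent ψ) {c : ℂ}
    (hc : 0 ≤ c.re) {z ξ : ℂ} (hz : z ∈ U) (h : ‖ξ‖ < ‖z‖) {s : ℝ} (hs : 0 ≤ s) :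
    eulerOp c ψ ξ ≠ eulerOp c ψ z + s * (z * deriv ψ z) := by
  intro heq
  have hξ : ξ ∈ U := mem_U.2 (h.trans (mem_U.1 hz))
  have hz0 : z ≠ 0 := norm_pos_iff.1 ((norm_nonneg _).trans_lt h)
  have hne : ψ ξ ≠ ψ z := fun h' => h.ne (by rw [hψ.1.2 hξ hz h'])
  obtain ⟨k, hk, hkz⟩ := hψ.exists_eulerOp_sub hc hz hξ
  have hk0 : k ≠ 0 := by
    rintro rfl
    simp at hk
  have hd0 : z * deriv ψ z ≠ 0 := mul_ne_zero hz0 (hψ.1.deriv_ne_zero hz)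
  -- The support inequality makes the real part of this quotient nonpositive, while `Re k⁻¹ > 0`.
  -- Hence `s = 0` and `ψ ξ = ψ z`.
  have h1 : (ψ ξ - ψ z) / (z * deriv ψ z) = s * k⁻¹ := by
    rw [heq, add_sub_cancel_left] at hkz
    rw [div_eq_iff hd0]
    refine mul_left_cancel₀ hk0 ?_
    rw [← hkz]
    field_simp
  have h2 := hψ.re_support hz h.le
  have h3 : 0 < (k⁻¹).re := by
    rw [inv_re]
    exact div_pos hk (normSq_pos.2 hk0)
  rw [h1, re_ofReal_mul] at h2
  have hs0 : s = 0 := le_antisymm (by nlinarith) hs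
  rw [hs0, ofReal_zero, zero_mul, div_eq_zero_iff] at h1
  exact h1.elim (fun h' => hne (sub_eq_zero.1 h')) hd0

/-- The functions `c ψ + t z ψ'`, `0 < t ≤ 1`, map disks into the images of these disks
under `c ψ + z ψ'`. -/
lemma ConvexUnivalent.mem_eulerOp_image {ψ : ℂ → ℂ} (hψ : ConvexUnivalent ψ) {c : ℂ}
    (hc : 0 ≤ c.re) {z : ℂ} (hz : z ∈ U) {t : ℝ} (ht0 : 0 < t) (ht1 : t ≤ 1) :
    ∃ ξ : ℂ, ‖ξ‖ ≤ ‖z‖ ∧ eulerOp c ψ ξ = c * ψ z + t * (z * deriv ψ z) := by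
  rcases eq_or_ne z 0 with rfl | hz0
  · exact ⟨0, le_rfl, by simp [eulerOp]⟩
  have hzn := norm_pos_iff.2 hz0
  have hsub : closedBall (0 : ℂ) ‖z‖ ⊆ U := closedBall_subset_ball (mem_U.1 hz)
  have hbsub : ball (0 : ℂ) ‖z‖ ⊆ U := ball_subset_closedBall.trans hsub
  set h := eulerOp c ψ with hh
  have hhol : Hol h := hψ.1.1.eulerOp c
  set b : ℂ → ℂ := fun x => c * ψ x + t * (x * deriv ψ x) with hb
  have hbhol : Hol b := DifferentiableOn.add (DifferentiableOn.const_mul hψ.1.1 c)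
    (DifferentiableOn.const_mul (DifferentiableOn.mul differentiableOn_id hψ.1.1.deriv) _)
  have htc : (t : ℂ) ≠ 0 := ofReal_ne_zero.2 ht0.ne'
  have hbt : ∀ x, b x = t * eulerOp (c / t) ψ x := by
    intro x
    simp only [hb, eulerOp]
    field_simp
  have hct : 0 ≤ (c / t).re := by
    rw [div_ofReal_re]
    positivity
  have hK : IsClosed (h '' closedBall 0 ‖z‖) :=
    ((isCompact_closedBall _ _).image_of_continuousOn (hhol.continuousOn.mono hsub)).isClosed
  have hcl : closure (h '' ball 0 ‖z‖) ⊆ h '' closedBall 0 ‖z‖ :=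
    closure_minimal (image_mono ball_subset_closedBall) hK
  -- Since `h x = t (E ψ x + ((1 - t) / t) x ψ'(x))` and `b = t E ψ`, with `E` taken for `c / t`,
  -- equality would place a value at `y` on a normal ray from the circle.
  have hdisj : ∀ x y, ‖x‖ = ‖z‖ → ‖y‖ < ‖z‖ → b y ≠ h x := by
    intro x y hx hy heq
    have hxU : x ∈ U := hsub (by simp [hx])
    refine hψ.eulerOp_ne_add hct hxU (hy.trans_eq hx.symm) (s := (1 - t) / t)
      (div_nonneg (by linarith) ht0.le) ?_
    refine mul_left_cancel₀ htc ?_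
    rw [← hbt, heq, hh, eulerOp, eulerOp]
    push_cast
    field_simp
    ring
  -- The connected set `b '' ball` meets the open set `h '' ball` at `b 0 = h 0` and, by `hdisj`,
  -- cannot leave it through the image of the circle.
  have hBA : b '' ball 0 ‖z‖ ⊆ h '' ball 0 ‖z‖ := by
    refine IsPreconnected.subset_of_closure_inter_subset ?_
      ((hψ.univalent_eulerOp hc).isOpen_image hbsub isOpen_ball) ?_ ?_
    · exact (convex_ball _ _).isPreconnected.image _ (hbhol.continuousOn.mono hbsub)
    · exact ⟨b 0, mem_image_of_mem b (mem_ball_self hzn), 0, mem_ball_self hzn,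
        by simp [hb, hh, eulerOp]⟩
    · rintro _ ⟨hv, y, hy, rfl⟩
      obtain ⟨x, hx, hxy⟩ := hcl hv
      rw [mem_closedBall_zero_iff] at hx
      rcases hx.lt_or_eq with hx | hx
      · exact ⟨x, mem_ball_zero_iff.2 hx, hxy⟩
      · exact absurd hxy.symm (hdisj x y hx (mem_ball_zero_iff.1 hy))
  have hzc : b z ∈ closure (b '' ball 0 ‖z‖) := by
    refine ContinuousWithinAt.mem_closure_image
      (hbhol.differentiableAt hz).continuousAt.continuousWithinAt ?_
    rw [closure_ball _ hzn.ne']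
    simp
  obtain ⟨ξ, hξ, hξz⟩ := hcl (closure_mono hBA hzc)
  exact ⟨ξ, mem_closedBall_zero_iff.1 hξ, hξz⟩

/-- Subordination for `c u + z u'` implies subordination of the functions. -/
theorem ConvexUnivalent.subordinate_of_eulerOp {ψ u : ℂ → ℂ} (hψ : ConvexUnivalent ψ) {c : ℂ}
    (hc : 0 ≤ c.re) (hu : Hol u) (h0 : u 0 = ψ 0)
    (h : Subordinate (eulerOp c u) (eulerOp c ψ)) : Subordinate u ψ := by
  by_contra hns
  obtain ⟨z, hz, ζ, hζ, hlt, huz, m, hm, hmz⟩ := hψ.1.exists_contact hu h0 hns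
  obtain ⟨w, -, hw, hwz⟩ := h
  -- At the contact point, `E u z = E ψ ζ + (m - 1) ζ ψ'(ζ)`.
  refine hψ.eulerOp_ne_add hc hζ ((hw z hz).trans_lt hlt) (s := m - 1) (by linarith) ?_
  rw [← hwz z hz, eulerOp, eulerOp, huz, hmz]
  push_cast
  ring

/-- Superordination for `c u + z u'` implies superordination of the functions. -/
theorem ConvexUnivalent.superordinate_of_eulerOp {ψ u : ℂ → ℂ} (hψ : ConvexUnivalent ψ) {c : ℂ}
    (hc : 0 ≤ c.re) (hu : Univalent u) (h0 : u 0 = ψ 0) (hinj : InjOn (eulerOp c u) U)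
    (h : Subordinate (eulerOp c ψ) (eulerOp c u)) : Subordinate ψ u := by
  by_contra hns
  obtain ⟨z, hz, ζ, hζ, hlt, hψz, m, hm, hmz⟩ := hu.exists_contact hψ.1.1 h0.symm hns
  obtain ⟨w, -, hw, hwz⟩ := h
  have hm0 : 0 < m := zero_lt_one.trans_le hm
  -- At the contact point, `E u ζ = c ψ(z) + m⁻¹ z ψ'(z)`, hence `t = m⁻¹`.
  obtain ⟨ξ, hξ, hξz⟩ := hψ.mem_eulerOp_image hc hz (inv_pos.2 hm0) (inv_le_one_of_one_le₀ hm)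
  have hξU : ξ ∈ U := mem_U.2 (hξ.trans_lt (mem_U.1 hz))
  have hwξ := hw ξ hξU
  have heq : eulerOp c u (w ξ) = eulerOp c u ζ := by
    have hmc : (m : ℂ) ≠ 0 := ofReal_ne_zero.2 hm0.ne'
    rw [← hwz ξ hξU, hξz, hψz, hmz, eulerOp, ofReal_inv, inv_mul_cancel_left₀ hmc]
  have := hinj (mem_U.2 (hwξ.trans_lt (mem_U.1 hξU))) hζ heq
  rw [this] at hwξ
  linarith

/-! ### Identification of `Φ` with `TΩ` -/

lemma MemA.hol {p : ℕ} {f : ℂ → ℂ} (hf : MemA p f) : Hol f := by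
  obtain ⟨g, hg, h⟩ := hf
  have hg' : DifferentiableOn ℂ g U := hg
  exact DifferentiableOn.congr (f := fun z => z ^ p + z ^ (p + 1) * g z) (by fun_prop) h

lemma MemA.apply_zero {p : ℕ} (hp : p ≠ 0) {f : ℂ → ℂ} (hf : MemA p f) : f 0 = 0 := by
  obtain ⟨g, hg, h⟩ := hf
  simp [h 0 zero_mem_U, hp]

lemma MemA.eventually_ne_zero {p : ℕ} {f : ℂ → ℂ} (hf : MemA p f) {z : ℂ} (hz : z ∈ U) :
    ∀ᶠ w in 𝓝[≠] z, f w ≠ 0 := by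
  by_contra hcon
  have h0 : EqOn f 0 U := hf.hol.analyticOnNhd.eqOn_zero_of_preconnected_of_frequently_eq_zero
    isPreconnected_U hz (by
      rw [Filter.not_eventually] at hcon
      exact hcon.mono fun _ => not_not.1)
  obtain ⟨g, hg, h⟩ := hf
  have hc : ContinuousAt (fun w => 1 + w * g w) 0 := by
    have := (hg.differentiableAt zero_mem_U).continuousAt
    fun_prop
  have hne : ∀ᶠ w in 𝓝 (0 : ℂ), 1 + w * g w ≠ 0 := hc.eventually_ne (by simp)
  obtain ⟨w, ⟨hw, hwU⟩, hw0⟩ := (((hne.and (isOpen_U.eventually_mem zero_mem_U)).filter_mono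
    nhdsWithin_le_nhds).and (self_mem_nhdsWithin : {(0 : ℂ)}ᶜ ∈ 𝓝[≠] (0 : ℂ))).exists
  have h1 : w ^ p * (1 + w * g w) = 0 := by
    have h2 : f w = 0 := h0 hwU
    rw [h w hwU] at h2
    linear_combination h2
  exact (mul_ne_zero (pow_ne_zero p hw0) hw) h1

/-- The logarithmic derivative of a product of real powers, for any holomorphic choice of its
values. -/
lemma deriv_of_value_rpow {Ω F G : ℂ → ℂ} {μ ν : ℝ} {z : ℂ}
    (hΩ : ∀ᶠ w in 𝓝 z, DifferentiableAt ℂ Ω w) (hF : ∀ᶠ w in 𝓝 z, DifferentiableAt ℂ F w)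
    (hG : ∀ᶠ w in 𝓝 z, DifferentiableAt ℂ G w)
    (h : ∀ᶠ w in 𝓝 z, ∃ s t : ℂ, exp s = F w ∧ exp t = G w ∧ Ω w = exp (μ * s + ν * t)) :
    deriv Ω z = Ω z * (μ * logDeriv F z + ν * logDeriv G z) := by
  obtain ⟨s₀, t₀, hs₀, ht₀, -⟩ := h.self_of_nhds
  have hFz : F z ≠ 0 := hs₀ ▸ exp_ne_zero _
  have hGz : G z ≠ 0 := ht₀ ▸ exp_ne_zero _
  have hslit : ∀ {H : ℂ → ℂ}, (∀ᶠ w in 𝓝 z, DifferentiableAt ℂ H w) → H z ≠ 0 →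
      ∀ᶠ w in 𝓝 z, H w / H z ∈ slitPlane := fun hH hHz =>
    (hH.self_of_nhds.continuousAt.div_const _).eventually_mem
      (isOpen_slitPlane.mem_nhds (by simp [hHz]))
  -- `E` is the reciprocal of a local holomorphic branch. The logarithms `s`, `t` are chosen
  -- pointwise, perhaps discontinuously, but as `μ` and `ν` are real, `‖Ω E‖` does not depend on the
  -- choice. It is constant, so `Ω E` is constant near `z` by the maximum principle.
  set E : ℂ → ℂ := fun w => exp (-(μ * log (F w / F z) + ν * log (G w / G z))) with hE
  have hEd : ∀ᶠ w in 𝓝 z, DifferentiableAt ℂ (fun w => Ω w * E w) w := by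
    filter_upwards [hΩ, hF, hG, hslit hF hFz, hslit hG hGz] with w h1 h2 h3 h4 h5
    have h6 := (h2.div_const (F z)).clog h4
    have h7 := (h3.div_const (G z)).clog h5
    exact h1.mul (((h6.const_mul _).add (h7.const_mul _)).neg.cexp)
  have hnorm : ∀ᶠ w in 𝓝 z, ‖Ω w * E w‖ = Real.exp (μ * Real.log ‖F z‖ + ν * Real.log ‖G z‖) := by
    filter_upwards [h] with w hw
    obtain ⟨s, t, hs, ht, hst⟩ := hw
    have hFw : F w ≠ 0 := hs ▸ exp_ne_zero _
    have hGw : G w ≠ 0 := ht ▸ exp_ne_zero _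
    have h1 : s.re = Real.log ‖F w‖ := by rw [← hs, Complex.norm_exp, Real.log_exp]
    have h2 : t.re = Real.log ‖G w‖ := by rw [← ht, Complex.norm_exp, Real.log_exp]
    rw [norm_mul, hst, hE, Complex.norm_exp, Complex.norm_exp, ← Real.exp_add]
    congr 1
    simp only [add_re, neg_re, re_ofReal_mul, log_re, norm_div, h1, h2]
    rw [Real.log_div (norm_ne_zero_iff.2 hFw) (norm_ne_zero_iff.2 hFz),
      Real.log_div (norm_ne_zero_iff.2 hGw) (norm_ne_zero_iff.2 hGz)]
    ring
  have hconst := eventually_eq_of_isLocalMax_norm hEd (by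
    filter_upwards [hnorm] with w hw
    simp only [Function.comp_apply]
    rw [hw, hnorm.self_of_nhds])
  have hlog : ∀ {H : ℂ → ℂ}, DifferentiableAt ℂ H z → H z ≠ 0 →
      HasDerivAt (fun w => log (H w / H z)) (logDeriv H z) z := by
    intro H hH hHz
    have := (hH.hasDerivAt.div_const (H z)).clog (by simp [hHz])
    simpa [hHz, logDeriv_apply] using this
  have hd : HasDerivAt (fun w => μ * log (F w / F z) + ν * log (G w / G z))
      (μ * logDeriv F z + ν * logDeriv G z) z :=
    ((hlog hF.self_of_nhds hFz).const_mul _).add ((hlog hG.self_of_nhds hGz).const_mul _)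
  have hΩE : Ω =ᶠ[𝓝 z]
      fun w => Ω z * exp (μ * log (F w / F z) + ν * log (G w / G z)) := by
    filter_upwards [hconst] with w hw
    have hEz : E z = 1 := by simp [hE, hFz, hGz]
    rw [hEz, mul_one, hE] at hw
    rw [← hw, mul_assoc, ← Complex.exp_add, neg_add_cancel, Complex.exp_zero, mul_one]
  rw [((hd.cexp.const_mul (Ω z)).congr_of_eventuallyEq hΩE).deriv]
  simp [hFz, hGz]

section Operators

variable {p : ℕ} {S : Set ℂ} {α : ℂ → ℂ} {L : ℂ → (ℂ → ℂ) → (ℂ → ℂ)} {a : ℂ} {μ ν : ℝ}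
  {f Ω : ℂ → ℂ}

lemma diffExpr_eq_eulerOp (α : ℂ → ℂ) (a : ℂ) (μ ν : ℝ) (u : ℂ → ℂ) (z : ℂ) :
    diffExpr α a μ ν u z = 1 / α (a + 1) * eulerOp (α (a + 1) * μ - α a * ν) u z := rfl

/-- In `zΩ'/Ω` the contributions of `z ^ p` cancel the `p` in both recurrences, which leaves `α (a +
1) Υ - (α (a + 1) μ - α a ν)`. -/
lemma MemO.mul_upsilon_eq_diffExpr (hL : MemO p S α L) (ha : a ∈ S) (hα : α (a + 1) ≠ 0)
    (hf : MemA p f) (hΩ : IsOmega L p a μ ν f Ω) {z : ℂ} (hz : z ∈ U) (hz0 : z ≠ 0)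
    (hA : L a f z ≠ 0) (hB : L (a + 1) f z ≠ 0) :
    Ω z * upsilon L p α a μ ν f z = diffExpr α a μ ν Ω z := by
  have ha1 := hL.shift a ha
  have hAd := (hL.mapsTo a ha f hf).hol
  have hBd := (hL.mapsTo (a + 1) ha1 f hf).hol
  have hev : ∀ᶠ w in 𝓝 z, w ∈ U ∧ w ≠ 0 ∧ L a f w ≠ 0 ∧ L (a + 1) f w ≠ 0 :=
    (isOpen_U.eventually_mem hz).and <| (eventually_ne_nhds hz0).and <|
      ((hAd.differentiableAt hz).continuousAt.eventually_ne hA).and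
        ((hBd.differentiableAt hz).continuousAt.eventually_ne hB)
  have hlog := deriv_of_value_rpow (Ω := Ω) (F := fun w => L (a + 1) f w / w ^ p)
    (G := fun w => w ^ p / L a f w) (μ := μ) (ν := ν) (z := z)
    (hev.mono fun w hw => hΩ.hol.differentiableAt hw.1)
    (hev.mono fun w hw => (hBd.differentiableAt hw.1).div (by fun_prop) (pow_ne_zero p hw.2.1))
    (hev.mono fun w hw => DifferentiableAt.div (by fun_prop) (hAd.differentiableAt hw.1) hw.2.2.1)
    (hev.mono fun w hw => hΩ.value w hw.1 hw.2.1 hw.2.2.1 hw.2.2.2)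
  have hpow : logDeriv (fun w : ℂ => w ^ p) z = p / z := by
    simp
  have hzp : z ^ p ≠ 0 := pow_ne_zero p hz0
  rw [logDeriv_div (g := fun w : ℂ => w ^ p) z hB hzp (hBd.differentiableAt hz) (by fun_prop),
    logDeriv_div (f := fun w : ℂ => w ^ p) z hzp hA (by fun_prop) (hAd.differentiableAt hz), hpow,
    logDeriv_apply, logDeriv_apply] at hlog
  have hrA := hL.recurrence a ha f hf z hz
  have hrB := hL.recurrence (a + 1) ha1 f hf z hz
  have hdA : deriv (L a f) z = (α a * L (a + 1) f z - (α a - p) * L a f z) / z := by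
    rw [← hrA, mul_div_cancel_left₀ _ hz0]
  have hdB : deriv (L (a + 1) f) z =
      (α (a + 1) * L (a + 1 + 1) f z - (α (a + 1) - p) * L (a + 1) f z) / z := by
    rw [← hrB, mul_div_cancel_left₀ _ hz0]
  rw [diffExpr, hlog, hdA, hdB, upsilon, omegaOne, omegaOne]
  field_simp
  ring

/-- The two sides agree on a punctured neighbourhood, and the right one is continuous at `z`. -/
lemma MemO.phi_eq_diffExpr (hp : p ≠ 0) (hL : MemO p S α L) (ha : a ∈ S) (hα : α (a + 1) ≠ 0)
    (hf : MemA p f) (hΩ : IsOmega L p a μ ν f Ω) {z : ℂ} (hz : z ∈ U) :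
    phi L p α a μ ν f Ω z = diffExpr α a μ ν Ω z := by
  have hA := hL.mapsTo a ha f hf
  have hB := hL.mapsTo (a + 1) (hL.shift a ha) f hf
  have hc : ContinuousAt (diffExpr α a μ ν Ω) z :=
    (((hΩ.hol.eulerOp _).differentiableAt hz).continuousAt).const_mul _
  refine Tendsto.limUnder_eq ((hc.tendsto.mono_left nhdsWithin_le_nhds).congr' ?_)
  filter_upwards [hA.eventually_ne_zero hz, hB.eventually_ne_zero hz,
    mem_nhdsWithin_of_mem_nhds (isOpen_U.mem_nhds hz)] with w h1 h2 h3
  refine (hL.mul_upsilon_eq_diffExpr ha hα hf hΩ h3 ?_ h1 h2).symm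
  rintro rfl
  exact h1 (hA.apply_zero hp)

end Operators

/-! ### Assembly of the theorem -/

lemma Subordinate.of_const_mul {K : ℂ} (hK : K ≠ 0) {F G f g : ℂ → ℂ} (h : Subordinate F G)
    (hF : ∀ z ∈ U, F z = K * f z) (hG : ∀ z ∈ U, G z = K * g z) : Subordinate f g := by
  obtain ⟨w, hw, hwz, hFG⟩ := h
  refine ⟨w, hw, hwz, fun z hz => mul_left_cancel₀ hK ?_⟩
  rw [← hF z hz, hFG z hz, hG _ (mem_U.2 ((hwz z hz).trans_lt (mem_U.1 hz)))]

lemma Subordinate.refl (f : ℂ → ℂ) : Subordinate f f :=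
  ⟨id, differentiableOn_id, fun _ _ => le_rfl, fun _ _ => rfl⟩

lemma MemH.hol {c : ℂ} {n : ℕ} {f : ℂ → ℂ} (hf : MemH c n f) : Hol f := by
  obtain ⟨g, hg, h⟩ := hf
  have hg' : DifferentiableOn ℂ g U := hg
  exact DifferentiableOn.congr (f := fun z => c + z ^ n * g z) (by fun_prop) h

lemma MemH.apply_zero {c : ℂ} {n : ℕ} (hn : n ≠ 0) {f : ℂ → ℂ} (hf : MemH c n f) : f 0 = c := by
  obtain ⟨g, hg, h⟩ := hf
  simp [h 0 zero_mem_U, hn]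

lemma Hol.memH_one {f : ℂ → ℂ} (hf : Hol f) : MemH (f 0) 1 f := by
  refine ⟨_, hf.dslope zero_mem_U, fun z _ => ?_⟩
  have := sub_smul_dslope f 0 z
  rw [sub_zero, smul_eq_mul] at this
  rw [pow_one, this]
  ring

/-- Supplies the univalence of `Ω` for the superordination theorem. -/
lemma MemQ.injOn {f : ℂ → ℂ} (hf : MemQ f) : InjOn f U := by
  obtain ⟨F, hF, -, hinj, -⟩ := hf
  have hsub : U ⊆ closedBall 0 1 \ excSet f := fun z hz =>
    ⟨ball_subset_closedBall hz, fun h => (mem_U.1 hz).ne (mem_sphere_zero_iff_norm.1 h.1)⟩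
  exact (hinj.mono hsub).congr hF

end GFT

theorem theorem1 (p : ℕ) (hp : 1 ≤ p) (S : Set ℂ) (α : ℂ → ℂ)
    (L : ℂ → (ℂ → ℂ) → (ℂ → ℂ)) (hL : GFT.MemO p S α L) (a : ℂ) (ha : a ∈ S)
    (μ ν : ℝ) (hμν : ¬ (μ = 0 ∧ ν = 0))
    (ψ : ℂ → ℂ) (hψ : GFT.ConvexUnivalent ψ) (hψ0 : ψ 0 = 1)
    (hre : 0 ≤ (α (a + 1) * μ - α a * ν).re) (hα : α (a + 1) ≠ 0)
    (f : ℂ → ℂ) (hf : GFT.MemA p f)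
    (Ω : ℂ → ℂ) (hΩ : GFT.IsOmega L p a μ ν f Ω)
    (χ : ℂ → ℂ)
    (hχ : ∀ z, χ z = 1 / α (a + 1) * ((α (a + 1) * μ - α a * ν) * ψ z + z * deriv ψ z))
    (Φ : ℂ → ℂ) (hΦ : Φ = GFT.phi L p α a μ ν f Ω) :
    (GFT.Subordinate Φ χ →
      GFT.Subordinate Ω ψ ∧ GFT.IsBestDominant (GFT.diffExpr α a μ ν) χ ψ) ∧
    (GFT.Subordinate χ Φ → GFT.MemH 1 1 Ω → GFT.MemQ Ω → GFT.Univalent Φ →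
      GFT.Subordinate ψ Ω ∧ GFT.IsBestSubordinant (GFT.diffExpr α a μ ν) χ ψ) := by
  have hK : 1 / α (a + 1) ≠ 0 := one_div_ne_zero hα
  obtain rfl : χ = GFT.diffExpr α a μ ν ψ := funext hχ
  have hΦT : EqOn Φ (GFT.diffExpr α a μ ν Ω) GFT.U := fun z hz => by
    rw [hΦ, hL.phi_eq_diffExpr (Nat.one_le_iff_ne_zero.1 hp) ha hα hf hΩ hz]
  have hψH : GFT.MemH 1 1 ψ := hψ0 ▸ hψ.1.1.memH_one
  -- A separate `F`, equal to `T u` only on the disk, covers both `Φ` and `T u` itself.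
  have dom : ∀ (u : ℂ → ℂ) (F : ℂ → ℂ), GFT.Hol u → u 0 = 1 →
      EqOn F (GFT.diffExpr α a μ ν u) GFT.U →
      GFT.Subordinate F (GFT.diffExpr α a μ ν ψ) → GFT.Subordinate u ψ :=
    fun u F hu hu0 hF h => hψ.subordinate_of_eulerOp hre hu (hu0.trans hψ0.symm)
      (h.of_const_mul hK hF fun _ _ => rfl)
  have sub : ∀ (u : ℂ → ℂ) (F : ℂ → ℂ), GFT.Univalent u → u 0 = 1 →
      EqOn F (GFT.diffExpr α a μ ν u) GFT.U → InjOn F GFT.U →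
      GFT.Subordinate (GFT.diffExpr α a μ ν ψ) F → GFT.Subordinate ψ u := by
    intro u F hu hu0 hF hinj h
    refine hψ.superordinate_of_eulerOp hre hu (hu0.trans hψ0.symm) ?_
      (h.of_const_mul hK (fun _ _ => rfl) hF)
    intro x hx y hy hxy
    refine hinj hx hy ?_
    rw [hF hx, hF hy, GFT.diffExpr_eq_eulerOp, GFT.diffExpr_eq_eulerOp, hxy]
  have hTψ : GFT.Univalent (GFT.diffExpr α a μ ν ψ) := by
    have h := hψ.univalent_eulerOp hre
    exact ⟨h.1.const_mul _, fun x hx y hy hxy => h.2 hx hy (mul_left_cancel₀ hK hxy)⟩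
  constructor
  · intro h
    refine ⟨dom Ω Φ hΩ.hol hΩ.at_zero hΦT h, ⟨hψ.1, fun u hu hu' => ?_⟩, fun q hq => ?_⟩
    · exact dom u _ hu.hol (hu.apply_zero one_ne_zero) (fun _ _ => rfl) hu'
    -- Any dominant must dominate the solution `ψ`.
    · exact hq.2 ψ hψH (GFT.Subordinate.refl _)
  · intro h _ hQ hΦu
    refine ⟨sub Ω Φ ⟨hΩ.hol, hQ.injOn⟩ hΩ.at_zero hΦT hΦu.2 h, hψ.1, ⟨hψ.1.1, ?_⟩, fun q hq => ?_⟩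
    · intro u hu huu hTu hu'
      exact sub u _ huu (hu.apply_zero one_ne_zero) (fun _ _ => rfl) hTu.2 hu'
    · exact hq.2 ψ hψH hψ.1 hTψ (GFT.Subordinate.refl _)
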